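/- **Model.** Let $G$ be the infinite triangular grid. A shape is a finite set $S$ of grid points, identified with the subgraph of $G$ it induces. The outer face of $S$ consists of the points outside $S$ lying in the unbounded face of $S$; the outer boundary of $S$ is the set of points of $S$ adjacent to the outer face. A *local boundary* of $v\in S$ is a maximal clockwise cyclic interval of edges at $v$ leading to points not in $S$; if it has $k$ edges, its boundary count is $k-2$. A point $v\in S$ on the outer boundary is *SCE* (strictly convex and erodable) w.r.t. $S$ if deleting $v$ does not disconnect its 1-hop neighbourhood in $S$ and $v$ has a local boundary with positive boundary count. A finite set of particles lives on $G$. Each particle occupies either one point (contracted; this point is both its head and its tail) or two adjacent points (expanded; head and tail). Each point is occupied by at most one particle, and the shape of the system is the set of occupied points. Two particles are neighbours if they occupy adjacent points. Each particle $p$ numbers the six edges at a point by ports $0,\dots,5$ in clockwise order (common chirality); the direction of port $0$ is arbitrary, may differ between particles, and does not change when $p$ moves. $port(p,u,v)$ is the port of $p$ leading from $u$ to the adjacent point $v$. The memory of $p$ consists of a read-only input $p.outer[0..5]$, the output $p.status\in\{undecided,leader,follower\}$, flags $p.eligible[0..5]$, and whether $p$ has terminated. *Initial configurations.* All particles are contracted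 and occupy distinct points, the shape of the system is non-empty and connected, and for each $p$: $p.outer[i]$ is true iff port $i$ of $p$ leads to a point in the outer face of the shape; $p.status=undecided$; $p.eligible[i]=\neg\, p.outer[i]$; $p$ has not terminated. *Algorithm DLE.* When $p$ is activated, it atomically performs the following (and does nothing if it has terminated). 1. If $p$ is expanded, it contracts into its head. 2. Otherwise, if $p.status\ne undecided$ and every neighbour $q$ of $p$ has $q.status\neq undecided$, then $p$ terminates. 3. Otherwise, if $p.status=undecided$, let $v$ be the point occupied by $p$. - If $p.eligible[i]=false$ for all $i$, then $p.status:=leader$. - Otherwise, if $v$ is SCE w.r.t. the set consisting of $v$ and of the points to which the ports $i$ with $p.eligible[i]=true$ lead, then first, for every neighbour $q$ of $p$ whose head $w$ is adjacent to $v$, $q.eligible[port(q,w,v)]:=false$. Then, if some port $i$ of $p$ with $p.eligible[i]=true$ leads to an empty point $u$ (any such $i$ may be used), $p$ sets $p.eligible[i+3 \bmod 6]:=false$, sets its five other eligible flags to $true$, and expands into $u$, which becomes its head while $v$ is its tail. If there is no such port, $p.status:=follower$. 4. In all other cases $p$ does nothing. An execution is a sequence $C_0,a_1,C_1,a_2,\dots$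 where $C_0$ is an initial configuration and $C_t$ results from $C_{t-1}$ by the atomic activation of the particle $a_t$; it is fair if every particle is activated infinitely often. The state of a particle (its memory and whether it is contracted) is final if from this state the particle does nothing when activated. **Theorem.** In every fair execution of Algorithm DLE there is a time $T$ such that in every configuration $C_t$ with $t\ge T$ all particles have terminated and are in a final state, exactly one particle has status $leader$, and all other particles have status $follower$. (Nothing is claimed about the connectivity of the shape of the system after time $0$.) -/

import Mathlib

namespace DLE

/-! ### The triangular grid and shapes -/

/-- A point of the triangular grid: `(a, b)` stands for the point `a • E + b • NE` of the plane. -/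
abbrev Point := ℤ × ℤ

/-- The six directions in clockwise order: E, SE, SW, W, NW, NE. -/
def dir (d : ZMod 6) : Point :=
  (![(1, 0), (1, -1), (0, -1), (-1, 0), (-1, 1), (0, 1)] : Fin 6 → ℤ × ℤ) d

/-- The neighbour of `v` in direction `d`. -/
def nbr (v : Point) (d : ZMod 6) : Point := v + dir d

theorem dir_add_three : ∀ d : ZMod 6, dir (d + 3) = -dir d := by decide

theorem dir_ne_zero : ∀ d : ZMod 6, dir d ≠ 0 := by decide

/-- The (infinite) triangular grid. -/
def grid : SimpleGraph Point where
  Adj u v := ∃ d, v = nbr u d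
  symm := ⟨by
    rintro u v ⟨d, rfl⟩
    exact ⟨d + 3, by simp [nbr, dir_add_three]⟩⟩
  loopless := ⟨by
    rintro u ⟨d, h⟩
    exact dir_ne_zero d (by simpa [nbr] using h)⟩

/-- The points of the outer (unbounded) face of the shape `S`. Two points outside `S` lie in the
same face iff a grid path that avoids `S` joins them, so a face is unbounded iff the corresponding
connected component of the complement is infinite. -/
def outerFace (S : Set Point) : Set Point :=
  {x | ∃ h : x ∈ Sᶜ, ((grid.induce Sᶜ).connectedComponentMk ⟨x, h⟩).supp.Infinite}

/-- The outer boundary of `S`: the points of `S` that lie on the outer face. -/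
def outerBoundary (S : Set Point) : Set Point :=
  {v | v ∈ S ∧ ∃ d, nbr v d ∈ outerFace S}

/-- `v` is redundant: its removal does not disconnect its 1-hop neighbourhood in `S`. -/
def IsRedundant (S : Set Point) (v : Point) : Prop :=
  v ∈ S ∧ (grid.induce {u | u ∈ S ∧ grid.Adj v u}).Preconnected

/-- The edges from `v` in the directions `d, d + 1, …, d + (k - 1)` form a local boundary of `v`:
a maximal clockwise cyclic interval of edges that lead outside `S`, of size `k`. -/
def IsLocalBoundary (S : Set Point) (v : Point) (d : ZMod 6) (k : ℕ) : Prop :=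
  v ∈ S ∧ 1 ≤ k ∧ (∀ j < k, nbr v (d + (j : ZMod 6)) ∉ S) ∧
    nbr v (d - 1) ∈ S ∧ nbr v (d + (k : ZMod 6)) ∈ S

/-- The boundary count of a local boundary of size `k`. -/
def boundaryCount (k : ℕ) : ℤ := (k : ℤ) - 2

/-- `v` is erodable with respect to `S`. -/
def IsErodable (S : Set Point) (v : Point) : Prop :=
  IsRedundant S v ∧ v ∈ outerBoundary S

/-- `v` is strictly convex and erodable with respect to `S`. (An erodable point with a neighbour
in `S` has exactly one local boundary.) -/
def IsSCE (S : Set Point) (v : Point) : Prop :=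
  IsErodable S v ∧ ∃ d k, IsLocalBoundary S v d k ∧ 0 < boundaryCount k

/-! ### Particle systems -/

inductive Status
  | undecided
  | leader
  | follower

/-- The local memory of a particle. -/
structure Memory where
  /-- read-only input: which ports initially lead to the outer face -/
  outer : ZMod 6 → Bool
  /-- the output variable -/
  status : Status
  /-- whether the point reached via a given port of the head is eligible -/
  eligible : ZMod 6 → Bool
  /-- whether the particle has executed the instruction to terminate -/
  terminated : Bool

/-- A configuration of a system of particles `P`. -/
structure Config (P : Type*) where
  head : P → Point
  tail : P → Point
  mem : P → Memory

variable {P : Type*}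

/-- The point `x` is occupied by the particle `p`. -/
def Config.Occupies (C : Config P) (p : P) (x : Point) : Prop := x = C.head p ∨ x = C.tail p

/-- The shape of the particle system: the set of occupied points. -/
def Config.shape (C : Config P) : Set Point := {x | ∃ p, C.Occupies p x}

def Config.Contracted (C : Config P) (p : P) : Prop := C.tail p = C.head p

/-- `q` is a neighbouring particle of `p`. -/
def Config.Neighbor (C : Config P) (p q : P) : Prop :=
  q ≠ p ∧ ∃ x y, C.Occupies p x ∧ C.Occupies q y ∧ grid.Adj x y

/-- The point reached from `u` via port `i` of `p`. Port `0` of `p` points in direction `ori p`,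
which is arbitrary, and ports are numbered clockwise by all particles (common chirality). Hence
`port(p, u, v) = i` means `reach ori p u i = v`. -/
def reach (ori : P → ZMod 6) (p : P) (u : Point) (i : ZMod 6) : Point := nbr u (ori p + i)

/-- The permitted initial configurations (connected, non-empty and contracted), with the memories
as initialized by the algorithm and with the outer boundary known. -/
structure IsInitial (ori : P → ZMod 6) (C : Config P) : Prop where
  contracted : ∀ p, C.Contracted p
  injective : Function.Injective C.head
  connected : (grid.induce C.shape).Connected
  outer : ∀ p i, (C.mem p).outer i = true ↔ reach ori p (C.head p) i ∈ outerFace C.shape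
  status : ∀ p, (C.mem p).status = Status.undecided
  eligible : ∀ p i, (C.mem p).eligible i = !(C.mem p).outer i
  terminated : ∀ p, (C.mem p).terminated = false

/-! ### Algorithm DLE -/

/-- What `p` knows of the set of eligible points around its head `v`: the point `v` itself and the
neighbours of `v` that are eligible according to `p.eligible`. -/
def Config.view (ori : P → ZMod 6) (C : Config P) (p : P) : Set Point :=
  {x | x = C.head p ∨ ∃ i, (C.mem p).eligible i = true ∧ x = reach ori p (C.head p) i}

open Classical in
/-- The particle `p` replaces its own memory by `m`. -/
noncomputable def Config.setMem (C : Config P) (p : P) (m : Memory) : Config P :=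
  { C with mem := Function.update C.mem p m }

open Classical in
/-- `p` contracts into its head. -/
noncomputable def Config.contract (C : Config P) (p : P) : Config P :=
  { C with tail := Function.update C.tail p (C.head p) }

open Classical in
/-- A contracted particle `p` expands into `u`. -/
noncomputable def Config.expand (C : Config P) (p : P) (u : Point) : Config P :=
  { C with head := Function.update C.head p u }

open Classical in
/-- For every neighbour `q` of `p` whose head `w` is adjacent to `v`, the particle `p` sets
`q.eligible[port(q, w, v)] := false`. -/
noncomputable def Config.notify (ori : P → ZMod 6) (C : Config P) (p : P) (v : Point) :
    Config P :=
  { C with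
    mem := fun q =>
      { C.mem q with
        eligible := fun i =>
          if C.Neighbor p q ∧ reach ori q (C.head q) i = v then false
          else (C.mem q).eligible i } }

open Classical in
/-- `Activate ori p C C'`: an atomic activation of `p` in the configuration `C` may result in the
configuration `C'`. -/
def Activate (ori : P → ZMod 6) (p : P) (C C' : Config P) : Prop :=
  let m := C.mem p
  let v := C.head p
  if m.terminated = true then
    C' = C
  else if ¬ C.Contracted p then
    C' = C.contract p
  else if m.status ≠ Status.undecided ∧
      ∀ q, C.Neighbor p q → (C.mem q).status ≠ Status.undecided then
    C' = C.setMem p { m with terminated := true }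
  else if m.status = Status.undecided then
    if ∀ i, m.eligible i = false then
      C' = C.setMem p { m with status := Status.leader }
    else if IsSCE (C.view ori p) v then
      if ∃ i, m.eligible i = true ∧ reach ori p v i ∉ C.shape then
        ∃ i, m.eligible i = true ∧ reach ori p v i ∉ C.shape ∧
          C' = ((C.notify ori p v).setMem p
            { m with eligible := fun j => if j = i + 3 then false else true }).expand p
              (reach ori p v i)
      else
        C' = (C.notify ori p v).setMem p { m with status := Status.follower }
    else
      C' = C
  else
    C' = C

/-! ### Executions -/

/-- An execution: `C t` is the configuration after `t` activations and `a t` is the particle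
activated next. -/
structure IsExecution (ori : P → ZMod 6) (C : ℕ → Config P) (a : ℕ → P) : Prop where
  init : IsInitial ori (C 0)
  step : ∀ t, Activate ori (a t) (C t) (C (t + 1))

/-- Every particle is activated infinitely often. -/
def IsFair (a : ℕ → P) : Prop := ∀ p t, ∃ s, t ≤ s ∧ a s = p

/-- The state of `p` in `C` (its memory, and whether it is contracted) is final: from this state
`p` does nothing when activated, whatever the rest of the configuration is. -/
def IsFinal (ori : P → ZMod 6) (C : Config P) (p : P) : Prop :=
  ∀ D D' : Config P, D.mem p = C.mem p → (D.Contracted p ↔ C.Contracted p) →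
    Activate ori p D D' → D' = D

/-- The predicate of the disconnecting leader election problem. -/
def LeaderElected (C : Config P) : Prop :=
  ∃ l, (C.mem l).status = Status.leader ∧ ∀ q, q ≠ l → (C.mem q).status = Status.follower

end DLE

/-! The proof follows a finite set `E` of eligible points, initially the complement of the outer
face (the shape with its holes filled). The invariant `Inv` says that `E` is non-empty and connected
with connected complement, that the flags of a particle whose head is in `E` describe `E` correctly
around that head, that undecided heads lie in `E` and follower heads do not, that a leader forces
`E` to be its own point, and that an unoccupied point of `E` has all six neighbours in `E`.

Under the invariant, a particle erodes its point `v` exactly when the neighbours of `v` in `E` form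
one arc of one to three consecutive points (`isSCE_iff`, `Inv.isSCE_view_iff`). Removing such a
point keeps `E` connected and free of holes. An empty eligible neighbour of `v`, having all its
neighbours in `E`, must be the middle of an arc of three (`IsShortArc.eq_middle`). There is thus at
most one, and expanding into it restores the condition on unoccupied points (`Inv.erase`).

Progress is possible while `E` has two points or more, by a discrete Gauss–Bonnet argument. The
curvature 6 - 3 deg + 2 tri sums to 6(V - edges + triangles), which is at least 6 for a non-empty
set without holes (`six_le_totalCurv`). So some point has positive curvature, and in a connected set
with another point this forces a short arc. That point has a neighbour outside `E`, so it is
occupied by the head of a particle, which is undecided.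

Every effective activation decreases `work`, so the execution becomes constant. By fairness no
particle can change the limit configuration, and then `Inv.elected` leaves only a singleton `E` with
the leader on it. -/

namespace DLE

/-! ### Directions and adjacency in the grid -/

section

theorem grid_adj_iff {u w : Point} : grid.Adj u w ↔
    (w.1 = u.1 + 1 ∧ w.2 = u.2) ∨ (w.1 = u.1 + 1 ∧ w.2 = u.2 - 1) ∨
    (w.1 = u.1 ∧ w.2 = u.2 - 1) ∨ (w.1 = u.1 - 1 ∧ w.2 = u.2) ∨
    (w.1 = u.1 - 1 ∧ w.2 = u.2 + 1) ∨ (w.1 = u.1 ∧ w.2 = u.2 + 1) := by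
  change (∃ d : Fin 6, w = u + (![(1, 0), (1, -1), (0, -1), (-1, 0), (-1, 1), (0, 1)] :
    Fin 6 → ℤ × ℤ) d) ↔ _
  simp [Fin.exists_fin_succ, Prod.ext_iff, sub_eq_add_neg]

theorem grid_adj_nbr (v : Point) (d : ZMod 6) : grid.Adj v (nbr v d) := ⟨d, rfl⟩

theorem dir_injective : Function.Injective dir := by
  have : ∀ a b : ZMod 6, dir a = dir b → a = b := by decide
  exact fun a b => this a b

theorem nbr_inj {v : Point} {a b : ZMod 6} : nbr v a = nbr v b ↔ a = b := by
  simp [nbr, dir_injective.eq_iff]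

theorem nbr_ne_self (v : Point) (d : ZMod 6) : nbr v d ≠ v := by
  simp [nbr, dir_ne_zero]

theorem nbr_nbr_opposite (v : Point) (d : ZMod 6) : nbr (nbr v d) (d + 3) = v := by
  simp [nbr, dir_add_three]

theorem nbr_eq_iff {u v : Point} {d : ZMod 6} : nbr u d = v ↔ u = nbr v (d + 3) := by
  simp only [nbr, dir_add_three]
  constructor
  · rintro rfl; simp
  · rintro rfl; simp

theorem nbr_nbr_add_two (v : Point) (d : ZMod 6) : nbr (nbr v d) (d + 2) = nbr v (d + 1) := by
  have h : ∀ d : ZMod 6, dir d + dir (d + 2) = dir (d + 1) := by decide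
  simp [nbr, add_assoc, h]

theorem nbr_nbr_sub_two (v : Point) (d : ZMod 6) : nbr (nbr v d) (d - 2) = nbr v (d - 1) := by
  have h : ∀ d : ZMod 6, dir d + dir (d - 2) = dir (d - 1) := by decide
  simp [nbr, add_assoc, h]

theorem grid_adj_nbr_nbr_iff {v : Point} {a b : ZMod 6} :
    grid.Adj (nbr v a) (nbr v b) ↔ b = a + 1 ∨ b = a - 1 := by
  have h : ∀ a b : ZMod 6, (∃ d, dir b = dir a + dir d) ↔ b = a + 1 ∨ b = a - 1 := by decide
  rw [← h]
  simp [grid, nbr, add_assoc]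

/-! ### Connectedness inside a set of grid points -/

/-- `x` and `y` are joined by a grid path inside `S`. -/
def Joined (S : Set Point) : Point → Point → Prop :=
  Relation.ReflTransGen fun x y => grid.Adj x y ∧ x ∈ S ∧ y ∈ S

/-- Any two points of `S` are joined by a grid path inside `S`. -/
def PathConnected (S : Set Point) : Prop := ∀ x ∈ S, ∀ y ∈ S, Joined S x y

variable {S T : Set Point} {x y z v : Point}

theorem Joined.refl (S : Set Point) (x : Point) : Joined S x x := Relation.ReflTransGen.refl

theorem Joined.trans (h : Joined S x y) (h' : Joined S y z) : Joined S x z :=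
  Relation.ReflTransGen.trans h h'

theorem Joined.symm (h : Joined S x y) : Joined S y x   := by
  induction h with
  | refl => exact .refl _ _
  | tail _ h ih => exact .head ⟨h.1.symm, h.2.2, h.2.1⟩ ih

theorem Joined.mono (hST : S ⊆ T) (h : Joined S x y) : Joined T x y :=
  Relation.ReflTransGen.mono (fun _ _ h => ⟨h.1, hST h.2.1, hST h.2.2⟩) _ _ h

theorem Joined.of_adj (h : grid.Adj x y) (hx : x ∈ S) (hy : y ∈ S) : Joined S x y :=
  Relation.ReflTransGen.single ⟨h, hx, hy⟩

/-- A path that starts in a set closed under the steps of the path stays in this set. -/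
theorem Joined.mem_of_closed (h : Joined S x y) (hx : x ∈ T)
    (hT : ∀ a ∈ T, ∀ b ∈ S, grid.Adj a b → b ∈ T) : y ∈ T := by
  induction h with
  | refl => exact hx
  | tail _ hbc ih => exact hT _ ih _ hbc.2.2 hbc.1

theorem reachable_induce_iff {x y : S} :
    (grid.induce S).Reachable x y ↔ Joined S x y := by
  rw [SimpleGraph.reachable_iff_reflTransGen]
  constructor
  · intro h
    induction h with
    | refl => exact .refl _ _
    | tail _ hbc ih => exact ih.tail ⟨hbc, Subtype.property _, Subtype.property _⟩
  · intro h
    obtain ⟨y, hy⟩ := y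
    change Joined S x y at h
    induction h with
    | refl => exact Relation.ReflTransGen.refl
    | tail _ hbc ih => exact Relation.ReflTransGen.tail (ih hbc.2.1) hbc.1

theorem preconnected_induce_iff : (grid.induce S).Preconnected ↔ PathConnected S := by
  constructor
  · intro h x hx y hy
    exact reachable_induce_iff.1 (h ⟨x, hx⟩ ⟨y, hy⟩)
  · intro h x y
    exact reachable_induce_iff.2 (h x x.2 y y.2)

theorem PathConnected.of_joined (c : Point) (h : ∀ x ∈ S, Joined S x c) : PathConnected S :=
  fun x hx y hy => (h x hx).trans (h y hy).symm

theorem PathConnected.insert (h : PathConnected S) (hx : x ∈ S) (hv : grid.Adj v x) :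
    PathConnected (insert v S) := by
  refine .of_joined x fun y hy => ?_
  rcases hy with rfl | hy
  · exact .of_adj hv (by simp) (by simp [hx])
  · exact (h y hy x hx).mono (by simp)

/-- A connected set with an isolated point has no other point. -/
theorem PathConnected.eq_of_isolated (h : PathConnected S) (hv : v ∈ S)
    (hn : ∀ d, nbr v d ∉ S) (hx : x ∈ S) : x = v := by
  refine (h v hv x hx).mem_of_closed (T := {v}) rfl ?_
  rintro a rfl b hb ⟨d, rfl⟩
  exact absurd hb (hn d)

theorem ray_injective (x : Point) (d : ZMod 6) :
    Function.Injective fun n : ℕ => x + n • dir d := by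
  intro m n h
  have h1 := congrArg Prod.fst h
  have h2 := congrArg Prod.snd h
  have h0 := dir_ne_zero d
  simp only [Prod.fst_add, Prod.snd_add, nsmul_eq_mul, Prod.fst_mul,
    Prod.snd_mul, Prod.fst_natCast, Prod.snd_natCast, add_right_inj, mul_eq_mul_right_iff, Nat.cast_inj] at h1 h2
  rw [ne_eq, Prod.ext_iff] at h0
  simp only [Prod.fst_zero, Prod.snd_zero] at h0
  tauto

theorem exists_ray_notMem (hS : S.Finite) (x : Point) (d : ZMod 6) :
    ∃ n : ℕ, x + n • dir d ∉ S := by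
  by_contra! h
  exact Set.infinite_of_injective_forall_mem (ray_injective x d) h hS

/-- A union of connected components of a finite set without holes has no holes. -/
theorem PathConnected.compl_of_components (hS : S.Finite) (h : PathConnected Sᶜ) (hT : T ⊆ S)
    (hc : ∀ a ∈ T, ∀ b ∈ S, grid.Adj a b → b ∈ T) : PathConnected Tᶜ := by
  -- An eastward walk that starts outside `T` cannot enter `T` before it has left `S`, because `T`
  -- is closed under adjacency within `S`.
  have key : ∀ n : ℕ, ∀ x ∈ Tᶜ, x + n • dir 0 ∉ S → ∃ y ∈ Sᶜ, Joined Tᶜ x y := by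
    intro n
    induction n with
    | zero => intro x hx hn; exact ⟨x, by simpa using hn, .refl _ _⟩
    | succ n ih =>
      intro x hx hn
      by_cases hxS : x ∈ S
      · have hx' : nbr x 0 ∈ Tᶜ := fun hm => hx (hc _ hm _ hxS (grid_adj_nbr x 0).symm)
        obtain ⟨y, hy, hj⟩ := ih (nbr x 0) hx' (by
          rwa [nbr, add_assoc, ← one_nsmul (dir 0), smul_smul, mul_one, ← add_nsmul,
            add_comm 1 n])
        exact ⟨y, hy, (Joined.of_adj (grid_adj_nbr x 0) hx hx').trans hj⟩
      · exact ⟨x, hxS, .refl _ _⟩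
  intro x hx y hy
  obtain ⟨n, hn⟩ := exists_ray_notMem hS x 0
  obtain ⟨m, hm⟩ := exists_ray_notMem hS y 0
  obtain ⟨x', hx', hxx⟩ := key n x hx hn
  obtain ⟨y', hy', hyy⟩ := key m y hy hm
  exact (hxx.trans ((h x' hx' y' hy').mono (Set.compl_subset_compl.2 hT))).trans hyy.symm

/-! ### A discrete winding number -/

/-- The signed crossing of the edge from `u` to `w` with the ray that leaves `x` eastwards, just
above the row of `x`. -/
def crossing (x u w : Point) : ℤ :=
  (if u.2 = x.2 ∧ w.2 = x.2 + 1 ∧ x.1 < u.1 then 1 else 0) -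
    (if w.2 = x.2 ∧ u.2 = x.2 + 1 ∧ x.1 < w.1 then 1 else 0)

/-- Moving the base point of the ray to an adjacent point changes the crossings of the edges that
avoid the two points by a coboundary. -/
theorem exists_crossing_sub_eq {x y : Point} (hxy : grid.Adj x y) : ∃ g : Point → ℤ,
    ∀ u w, grid.Adj u w → u ≠ x → u ≠ y → w ≠ x → w ≠ y →
      crossing x u w - crossing y u w = g w - g u := by
  -- Three of the six directions suffice: exchanging `x` and `y` changes the sign of `g`.
  have up : ∀ x y : Point, (y.1 = x.1 + 1 ∧ y.2 = x.2) ∨ (y.1 = x.1 ∧ y.2 = x.2 + 1) ∨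
      (y.1 = x.1 - 1 ∧ y.2 = x.2 + 1) → ∃ g : Point → ℤ,
      ∀ u w, grid.Adj u w → u ≠ x → u ≠ y → w ≠ x → w ≠ y →
        crossing x u w - crossing y u w = g w - g u := by
    intro x y h
    simp only [ne_eq, Prod.ext_iff, grid_adj_iff, crossing]
    rcases h with h | h | h
    · refine ⟨0, fun u w hadj h1 h2 h3 h4 => ?_⟩
      simp only [Pi.zero_apply]
      omega
    -- The points of the row of `y` strictly east of `y` are those between the two rays. The two
    -- crossings of an edge differ according to whether it enters or leaves this set.
    · refine ⟨fun u => if u.2 = y.2 ∧ y.1 < u.1 then 1 else 0, fun u w hadj h1 h2 h3 h4 => ?_⟩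
      dsimp only
      rcases hadj with e | e | e | e | e | e <;> simp only [e] at * <;> split_ifs <;> omega
    · refine ⟨fun u => if u.2 = y.2 ∧ y.1 < u.1 then 1 else 0, fun u w hadj h1 h2 h3 h4 => ?_⟩
      dsimp only
      rcases hadj with e | e | e | e | e | e <;> simp only [e] at * <;> split_ifs <;> omega
  rw [grid_adj_iff] at hxy
  by_cases h : (y.1 = x.1 + 1 ∧ y.2 = x.2) ∨ (y.1 = x.1 ∧ y.2 = x.2 + 1) ∨
      (y.1 = x.1 - 1 ∧ y.2 = x.2 + 1)
  · exact up x y h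
  · obtain ⟨g, hg⟩ := up y x (by omega)
    refine ⟨fun u => -g u, fun u w ha h1 h2 h3 h4 => ?_⟩
    have := hg u w ha h2 h1 h4 h3
    linarith

end

section

/-- The path from `u` to `w` in `S` has, for each base point outside `S`, a total crossing number,
which changes with the base point by the coboundary of `exists_crossing_sub_eq`. -/
theorem Joined.exists_total_crossing {S : Set Point} {u w : Point} (h : Joined S u w) :
    ∃ N : Point → ℤ,
      (∀ x, (∀ a ∈ S, ∀ b ∈ S, grid.Adj a b → crossing x a b = 0) → N x = 0) ∧
      ∀ x y, ∀ g : Point → ℤ,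
        (∀ a ∈ S, ∀ b ∈ S, grid.Adj a b → crossing x a b - crossing y a b = g b - g a) →
          N x - N y = g w - g u := by
  induction h with
  | refl => exact ⟨0, fun _ _ => rfl, fun x y g _ => by simp⟩
  | @tail b c _ hbc ih =>
    obtain ⟨N, h0, h1⟩ := ih
    refine ⟨fun x => N x + crossing x b c, fun x hx => ?_, fun x y g hg => ?_⟩
    · simp [h0 x hx, hx b hbc.2.1 c hbc.2.2 hbc.1]
    · have := h1 x y g hg
      have := hg b hbc.2.1 c hbc.2.2 hbc.1
      linarith

/-- If the highest and then easternmost point `v` of a set without holes has neighbours to the west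
and to the southeast but not to the southwest, then `v` is a cut point. -/
theorem not_joined_of_top {S : Set Point} {v : Point} (hS : PathConnected Sᶜ)
    (htop : ∀ u ∈ S, u.2 < v.2 ∨ (u.2 = v.2 ∧ u.1 ≤ v.1)) (hv : v ∈ S)
    (h1 : nbr v 1 ∈ S) (h2 : nbr v 2 ∉ S) (h3 : nbr v 3 ∈ S) :
    ¬ Joined (S \ {v}) (nbr v 1) (nbr v 3) := by
  intro hj
  obtain ⟨N, hN0, hN⟩ := hj.exists_total_crossing
  have e1 : nbr v 1 = (v.1 + 1, v.2 - 1) := rfl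
  have e2 : nbr v 2 = (v.1 + 0, v.2 - 1) := rfl
  have e3 : nbr v 3 = (v.1 - 1, v.2 + 0) := rfl
  have e5 : nbr v 5 = (v.1 + 0, v.2 + 1) := rfl
  have h5 : nbr v 5 ∉ S := by
    intro h
    have := htop _ h
    rw [e5] at this
    simp at this
  -- The winding number around `x` of the path closed up through `v`. Over a closed path a
  -- coboundary sums to zero, so `W` is constant along paths outside `S`.
  let W : Point → ℤ := fun x => N x + crossing x (nbr v 3) v + crossing x v (nbr v 1)
  have hW : ∀ x, Joined Sᶜ (nbr v 2) x → W x = W (nbr v 2) := by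
    intro x hx
    induction hx with
    | refl => rfl
    | @tail x y _ hxy ih =>
      obtain ⟨g, hg⟩ := exists_crossing_sub_eq hxy.1
      have hg' : ∀ a ∈ S, ∀ b ∈ S, grid.Adj a b →
          crossing x a b - crossing y a b = g b - g a := by
        intro a ha b hb hab
        apply hg a b hab
        · rintro rfl; exact hxy.2.1 ha
        · rintro rfl; exact hxy.2.2 ha
        · rintro rfl; exact hxy.2.1 hb
        · rintro rfl; exact hxy.2.2 hb
      have a1 := hN x y g fun a ha b hb => hg' a ha.1 b hb.1
      have a2 := hg' _ h3 _ hv (grid_adj_nbr v 3).symm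
      have a3 := hg' _ hv _ h1 (grid_adj_nbr v 1)
      rw [← ih]
      simp only [W]
      linarith
  -- The ray runs above all of `S`.
  have w5 : W (nbr v 5) = 0 := by
    have : ∀ a ∈ S, ∀ b ∈ S, crossing (nbr v 5) a b = 0 := by
      intro a ha b hb
      have := htop a ha
      have := htop b hb
      simp only [crossing, e5]
      split_ifs <;> omega
    simp only [W]
    rw [hN0 _ fun a ha b hb _ => this a ha.1 b hb.1, this _ h3 _ hv, this _ hv _ h1]
    rfl
  -- A crossed edge has its lower end strictly east of the column of `v`, so its upper end, in the
  -- row of `v`, is not west of `v`. By the choice of `v` that end is `v` itself, which the path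
  -- avoids. Only the closing edge from `v` to `nbr v 1` remains, crossed downwards.
  have w2 : W (nbr v 2) = -1 := by
    have c3 : crossing (nbr v 2) (nbr v 3) v = 0 := by
      simp only [crossing, e2, e3]
      split_ifs <;> omega
    have c1 : crossing (nbr v 2) v (nbr v 1) = -1 := by
      simp [crossing, e1, e2]
    simp only [W]
    rw [c3, c1, hN0]
    · rfl
    · intro a ha b hb hab
      have ta := htop a ha.1
      have tb := htop b hb.1
      have na : a ≠ v := ha.2
      have nb : b ≠ v := hb.2
      rw [ne_eq, Prod.ext_iff] at na nb
      rw [grid_adj_iff] at hab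
      simp only [crossing, e2]
      split_ifs <;> omega
  have := hW _ (hS _ h2 _ h5)
  omega

/-! ### Curvature -/

/-- The indicator function of `E`. -/
def ind (E : Finset Point) (x : Point) : ℤ := if x ∈ E then 1 else 0

/-- The number of neighbours of `v` in `E`. -/
def deg (E : Finset Point) (v : Point) : ℤ := ∑ d : ZMod 6, ind E (nbr v d)

/-- The number of triangles with the apex `v` and the other two corners in `E`. -/
def tri (E : Finset Point) (v : Point) : ℤ :=
  ∑ d : ZMod 6, ind E (nbr v d) * ind E (nbr v (d + 1))

/-- Six times the curvature of `E` at `v`. -/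
def curv (E : Finset Point) (v : Point) : ℤ := 6 - 3 * deg E v + 2 * tri E v

/-- The total curvature of `E`: six times the Euler characteristic. -/
def totalCurv (E : Finset Point) : ℤ := ∑ v ∈ E, curv E v

variable {E A B : Finset Point} {v x : Point}

theorem ind_insert (hv : v ∉ E) (x : Point) :
    ind (insert v E) x = ind E x + if x = v then 1 else 0 := by
  by_cases h : x = v
  · subst h; simp [ind, hv]
  · simp [ind, h]

theorem sum_ite_nbr_eq (f : Point → ℤ) (d : ZMod 6) :
    ∑ u ∈ E, (if nbr u d = v then f u else 0) =
      ind E (nbr v (d + 3)) * f (nbr v (d + 3)) := by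
  simp [nbr_eq_iff, ind]

theorem sum_deg_insert (hv : v ∉ E) :
    ∑ u ∈ E, deg (insert v E) u = ∑ u ∈ E, deg E u + deg E v := by
  simp only [deg, ind_insert hv, Finset.sum_add_distrib, add_right_inj]
  rw [Finset.sum_comm]
  refine Fintype.sum_equiv (Equiv.addRight (3 : ZMod 6)) _ _ fun d => ?_
  rw [sum_ite_nbr_eq fun _ => 1, mul_one, Equiv.coe_addRight]

/-- Each new triangle is seen from both of its corners other than `v`, hence the factor 2. The two
sums match these corners with a direction at `v`, after a shift by 2 or by 4. -/
theorem sum_tri_insert (hv : v ∉ E) :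
    ∑ u ∈ E, tri (insert v E) u = ∑ u ∈ E, tri E u + 2 * tri E v := by
  have key : ∀ u d, ind (insert v E) (nbr u d) * ind (insert v E) (nbr u (d + 1)) =
      ind E (nbr u d) * ind E (nbr u (d + 1)) +
        ((if nbr u d = v then ind E (nbr u (d + 1)) else 0) +
          if nbr u (d + 1) = v then ind E (nbr u d) else 0) := by
    intro u d
    have : ¬ (nbr u d = v ∧ nbr u (d + 1) = v) := by
      rintro ⟨h1, h2⟩
      have := nbr_inj.1 (h1.trans h2.symm)
      exact absurd (left_eq_add.1 this) (by decide)
    rw [ind_insert hv, ind_insert hv]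
    split_ifs <;> first | (exfalso; tauto) | ring
  simp only [tri, key, Finset.sum_add_distrib, add_right_inj, two_mul]
  congr 1
  · rw [Finset.sum_comm]
    refine Fintype.sum_equiv (Equiv.addRight (2 : ZMod 6)) _ _ fun d => ?_
    have h : ∀ d : ZMod 6, dir (d + 3) + dir (d + 1) = dir (d + 2) := by decide
    have h3 : d + 2 + 1 = d + 3 := by ring
    have h4 : nbr (nbr v (d + 3)) (d + 1) = nbr v (d + 2) := by simp only [nbr, add_assoc, h]
    rw [sum_ite_nbr_eq fun u => ind E (nbr u (d + 1)), Equiv.coe_addRight, h3, h4, mul_comm]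
  · rw [Finset.sum_comm]
    refine Fintype.sum_equiv (Equiv.addRight (4 : ZMod 6)) _ _ fun d => ?_
    have h : ∀ d : ZMod 6, dir (d + 4) + dir d = dir (d + 4 + 1) := by decide
    have h3 : d + 1 + 3 = d + 4 := by ring
    have h4 : nbr (nbr v (d + 4)) d = nbr v (d + 4 + 1) := by rw [nbr, nbr, nbr, add_assoc, h]
    rw [sum_ite_nbr_eq fun u => ind E (nbr u d), Equiv.coe_addRight, h3, h4]

theorem deg_insert_self (hv : v ∉ E) : deg (insert v E) v = deg E v := by
  simp [deg, ind_insert hv, nbr_ne_self]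

theorem tri_insert_self (hv : v ∉ E) : tri (insert v E) v = tri E v := by
  simp [tri, ind_insert hv, nbr_ne_self]

/-- The point `v` contributes one vertex, `deg E v` edges and `tri E v` triangles to the Euler
characteristic. -/
theorem totalCurv_insert (hv : v ∉ E) :
    totalCurv (insert v E) = totalCurv E + 6 * (1 - deg E v + tri E v) := by
  simp only [totalCurv, Finset.sum_insert hv, curv, Finset.sum_add_distrib,
    Finset.sum_sub_distrib, ← Finset.mul_sum, sum_deg_insert hv, sum_tri_insert hv,
    deg_insert_self hv, tri_insert_self hv]
  ring

theorem totalCurv_union (hd : Disjoint A B)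
    (hadj : ∀ a ∈ A, ∀ b ∈ B, ¬ grid.Adj a b) :
    totalCurv (A ∪ B) = totalCurv A + totalCurv B := by
  have hA : ∀ u ∈ A, ∀ d, ind (A ∪ B) (nbr u d) = ind A (nbr u d) := by
    intro u hu d
    have : nbr u d ∉ B := fun h => hadj u hu _ h (grid_adj_nbr u d)
    simp [ind, this]
  have hB : ∀ u ∈ B, ∀ d, ind (A ∪ B) (nbr u d) = ind B (nbr u d) := by
    intro u hu d
    have : nbr u d ∉ A := fun h => hadj _ h u hu (grid_adj_nbr u d).symm
    simp [ind, this]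
  rw [totalCurv, Finset.sum_union hd]
  congr 1
  · refine Finset.sum_congr rfl fun u hu => ?_
    simp [curv, deg, tri, hA u hu]
  · refine Finset.sum_congr rfl fun u hu => ?_
    simp [curv, deg, tri, hB u hu]

/-- A finite non-empty set without holes has a positive Euler characteristic. -/
theorem six_le_totalCurv (E : Finset Point) (hne : E.Nonempty)
    (hE : PathConnected (E : Set Point)ᶜ) : 6 ≤ totalCurv E := by
  induction E using Finset.strongInduction with
  | H E ih =>
  -- The easternmost point of the top row has no neighbours in `E` in the directions 0, 4 and 5.
  obtain ⟨v, hv, hmax⟩ := E.exists_max_image (fun u => toLex (u.2, u.1)) hne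
  have htop : ∀ u ∈ (E : Set Point), u.2 < v.2 ∨ (u.2 = v.2 ∧ u.1 ≤ v.1) := by
    intro u hu
    have := hmax u hu
    rwa [Prod.Lex.toLex_le_toLex] at this
  obtain ⟨E', hvE', rfl⟩ : ∃ E', v ∉ E' ∧ insert v E' = E :=
    ⟨E.erase v, by simp, Finset.insert_erase hv⟩
  have htop' : ∀ u ∈ E', u.2 < v.2 ∨ (u.2 = v.2 ∧ u.1 ≤ v.1) :=
    fun u hu => htop u (by simp [hu])
  have n0 : ind E' (nbr v 0) = 0 := by
    refine if_neg fun h => ?_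
    have := htop' _ h
    rw [show nbr v 0 = (v.1 + 1, v.2 + 0) from rfl] at this
    simp at this
  have n4 : ind E' (nbr v 4) = 0 := by
    refine if_neg fun h => ?_
    have := htop' _ h
    rw [show nbr v 4 = (v.1 - 1, v.2 + 1) from rfl] at this
    simp at this
  have n5 : ind E' (nbr v 5) = 0 := by
    refine if_neg fun h => ?_
    have := htop' _ h
    rw [show nbr v 5 = (v.1 + 0, v.2 + 1) from rfl] at this
    simp at this
  have hdeg : deg E' v = ind E' (nbr v 1) + ind E' (nbr v 2) + ind E' (nbr v 3) := by
    have : deg E' v = ind E' (nbr v 0) + ind E' (nbr v 1) + ind E' (nbr v 2) + ind E' (nbr v 3)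
      + ind E' (nbr v 4) + ind E' (nbr v 5) := Fin.sum_univ_six _
    rw [this, n0, n4, n5]; ring
  have htri : tri E' v = ind E' (nbr v 1) * ind E' (nbr v 2) +
      ind E' (nbr v 2) * ind E' (nbr v 3) := by
    have : tri E' v = ind E' (nbr v 0) * ind E' (nbr v 1) + ind E' (nbr v 1) * ind E' (nbr v 2)
      + ind E' (nbr v 2) * ind E' (nbr v 3) + ind E' (nbr v 3) * ind E' (nbr v 4)
      + ind E' (nbr v 4) * ind E' (nbr v 5) + ind E' (nbr v 5) * ind E' (nbr v 0) :=
        Fin.sum_univ_six _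
    rw [this, n0, n4, n5]; ring
  have hco : PathConnected (E' : Set Point)ᶜ := by
    have h5 : nbr v 5 ∈ ((insert v E' : Finset Point) : Set Point)ᶜ := by
      intro h
      have := htop _ h
      rw [show nbr v 5 = (v.1 + 0, v.2 + 1) from rfl] at this
      simp at this
    have := hE.insert h5 (grid_adj_nbr v 5)
    convert this using 1
    ext x
    by_cases hx : x = v <;> simp [hx, hvE']
  rw [totalCurv_insert hvE', hdeg, htri]
  have hss : E' ⊂ insert v E' := Finset.ssubset_insert hvE'
  -- The change 1 - deg + tri is 1 if `v` has no neighbours, -1 in this case, and 0 otherwise. Here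
  -- `v` is a cut point, and the two hole-free pieces contribute at least 6 each, which pays for the
  -- loss of 6.
  by_cases hcut : nbr v 1 ∈ E' ∧ nbr v 2 ∉ E' ∧ nbr v 3 ∈ E'
  · obtain ⟨h1, h2, h3⟩ := hcut
    have hnj := not_joined_of_top hE htop (by simp) (by simp [h1])
      (by simp [h2, nbr_ne_self]) (by simp [h3])
    have hdiff : ((insert v E' : Finset Point) : Set Point) \ {v} = E' := by
      ext x
      by_cases hx : x = v <;> simp [hx, hvE']
    rw [hdiff] at hnj
    classical
    set A := E'.filter fun x => Joined E' (nbr v 1) x with hA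
    set B := E'.filter fun x => ¬ Joined E' (nbr v 1) x with hB
    have hAB : A ∪ B = E' := Finset.filter_union_filter_not_eq _ _
    have hdis : Disjoint A B := Finset.disjoint_filter_filter_not _ _ _
    have hadj : ∀ a ∈ A, ∀ b ∈ B, ¬ grid.Adj a b := by
      intro a ha b hb hab
      rw [Finset.mem_filter] at ha hb
      exact hb.2 (ha.2.trans (.of_adj hab ha.1 hb.1))
    have hAE : A ⊆ E' := Finset.filter_subset _ _
    have hBE : B ⊆ E' := Finset.filter_subset _ _
    have cA := ih A (hAE.trans_ssubset hss) ⟨nbr v 1, by simp [hA, h1, Joined.refl]⟩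
      (hco.compl_of_components E'.finite_toSet (by exact_mod_cast hAE) fun a ha b hb hab => by
        rw [Finset.mem_coe, ← hAB, Finset.mem_union] at hb
        exact hb.resolve_right fun hb => hadj a ha b hb hab)
    have cB := ih B (hBE.trans_ssubset hss) ⟨nbr v 3, by simp [hB, h3, hnj]⟩
      (hco.compl_of_components E'.finite_toSet (by exact_mod_cast hBE) fun a ha b hb hab => by
        rw [Finset.mem_coe, ← hAB, Finset.mem_union] at hb
        exact hb.resolve_left fun hb => hadj b hb a ha hab.symm)
    have := totalCurv_union hdis hadj
    rw [hAB] at this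
    simp only [ind, h1, h2, h3, if_true, if_false]
    linarith
  · rcases E'.eq_empty_or_nonempty with rfl | hne'
    · simp [ind, totalCurv]
    · have := ih E' hss hne' hco
      simp only [ind]
      split_ifs <;> first | (exfalso; tauto) | linarith

end

section

/-! ### Points with few consecutive neighbours -/

/-- The neighbours of `v` in `S` are the ones in the directions `d, …, d + (k - 1)`, where
`1 ≤ k ≤ 3`. -/
structure IsShortArc (S : Set Point) (v : Point) (d : ZMod 6) (k : ℕ) : Prop where
  one_le : 1 ≤ k
  le_three : k ≤ 3
  mem_iff : ∀ j : ZMod 6, nbr v (d + j) ∈ S ↔ j.val < k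

variable {S T : Set Point} {v : Point} {d : ZMod 6} {k : ℕ}

theorem IsShortArc.nbr_mem_iff (h : IsShortArc S v d k) (i : ℕ) (hi : i < 6) :
    nbr v (d + (i : ZMod 6)) ∈ S ↔ i < k := by
  rw [h.mem_iff, ZMod.val_natCast_of_lt hi]

theorem joined_consecutive (n : ℕ) (hT : ∀ i < n, nbr v (d + (i : ZMod 6)) ∈ T) :
    ∀ i < n, Joined T (nbr v (d + (i : ZMod 6))) (nbr v d) := by
  intro i
  induction i with
  | zero => intro _; simpa using Joined.refl T (nbr v d)
  | succ i ih =>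
    intro hi
    refine .trans (.of_adj ?_ (hT _ hi) (hT i (by omega))) (ih (by omega))
    rw [grid_adj_nbr_nbr_iff]
    right
    push_cast
    ring

theorem IsShortArc.joined (h : IsShortArc S v d k)
    (hT : ∀ e, nbr v e ∈ S → nbr v e ∈ T) (e : ZMod 6) (he : nbr v e ∈ S) :
    Joined T (nbr v e) (nbr v d) := by
  have hj : e = d + ((e - d).val : ZMod 6) := by simp
  have hk : (e - d).val < k := by rwa [← h.mem_iff, add_sub_cancel]
  rw [hj]
  refine joined_consecutive k (fun i hi => hT _ ?_) _ hk
  rwa [h.nbr_mem_iff i (by have := h.le_three; omega)]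

theorem IsShortArc.nbr_mem (h : IsShortArc S v d k) : nbr v d ∈ S := by
  have := (h.nbr_mem_iff 0 (by omega)).2 h.one_le
  simpa using this

/-- Removing a point with few consecutive neighbours preserves connectedness. -/
theorem IsShortArc.pathConnected_diff (h : IsShortArc S v d k) (hv : v ∈ S)
    (hS : PathConnected S) : PathConnected (S \ {v}) := by
  refine .of_joined (nbr v d) ?_
  rintro x ⟨hx, hxv⟩
  have hp := hS x hx v hv
  induction hp using Relation.ReflTransGen.head_induction_on with
  | refl => exact absurd rfl hxv
  | @head a b hab _ ih =>
    by_cases hb : b = v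
    · subst hb
      obtain ⟨e, rfl⟩ := hab.1.symm
      exact h.joined (T := S \ {b}) (fun e he => ⟨he, nbr_ne_self b e⟩) e hx
    · exact (Joined.of_adj (S := S \ {v}) hab.1 ⟨hx, hxv⟩ ⟨hab.2.2, hb⟩).trans (ih hab.2.2 hb)

/-- Removing a point with a missing neighbour does not create holes. -/
theorem PathConnected.compl_diff (hS : PathConnected Sᶜ) {e : ZMod 6} (he : nbr v e ∉ S) :
    PathConnected (S \ {v})ᶜ := by
  convert hS.insert he (grid_adj_nbr v e) using 1
  ext x
  by_cases hx : x = v <;> simp [hx]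

theorem IsShortArc.exists_nbr_notMem (h : IsShortArc S v d k) : ∃ e, nbr v e ∉ S :=
  ⟨d + (3 : ℕ), by rw [h.nbr_mem_iff 3 (by omega)]; have := h.le_three; omega⟩

/-- If all neighbours of the neighbour `u` of `v` belong to `S`, then `u` is the middle one of
three consecutive neighbours of `v`. -/
theorem IsShortArc.eq_middle (h : IsShortArc S v d k) {e : ZMod 6} (hmem : nbr v e ∈ S)
    (he : ∀ j, nbr (nbr v e) j ∈ S) : e = d + 1 := by
  have h1 := he (e + 2)
  have h2 := he (e - 2)
  rw [nbr_nbr_add_two] at h1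
  rw [nbr_nbr_sub_two] at h2
  have key : ∀ j : ZMod 6, j.val < 3 → (j + 1).val < 3 → (j - 1).val < 3 → j = 1 := by decide
  have hk := h.le_three
  have := key (e - d) (by
      rw [show e = d + (e - d) by ring, h.mem_iff] at hmem; omega)
    (by rw [show e + 1 = d + (e - d + 1) by ring, h.mem_iff] at h1; omega)
    (by rw [show e - 1 = d + (e - d - 1) by ring, h.mem_iff] at h2; omega)
  rw [← this]
  ring

/-- If the neighbours form r ≥ 1 arcs with gaps between them, then tri = deg - r, and positivity
reads deg + 2r < 6; as deg ≥ r, this leaves r = 1 and deg ≤ 3. A full ring of six has curvature 0.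
The 64 patterns are checked by evaluation. -/
theorem exists_short_arc_of_bool (m : ZMod 6 → Bool) (hm : ∃ d, m d = true)
    (h : 0 < 6 - 3 * ∑ d, (if m d = true then 1 else 0 : ℤ) +
      2 * ∑ d, (if m d = true then 1 else 0 : ℤ) * (if m (d + 1) = true then 1 else 0)) :
    ∃ d : ZMod 6, ∃ k : ℕ, 1 ≤ k ∧ k ≤ 3 ∧ ∀ j : ZMod 6, m (d + j) = true ↔ j.val < k := by
  have key : ∀ m : ZMod 6 → Bool, (∃ d, m d = true) →
      0 < 6 - 3 * ∑ d, (if m d = true then 1 else 0 : ℤ) +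
        2 * ∑ d, (if m d = true then 1 else 0 : ℤ) * (if m (d + 1) = true then 1 else 0) →
      ∃ d : ZMod 6, ∃ k : Fin 4, 1 ≤ k.val ∧ ∀ j : ZMod 6, m (d + j) = true ↔ j.val < k := by
    decide +kernel
  obtain ⟨d, k, hk, hd⟩ := key m hm h
  exact ⟨d, k, hk, by omega, hd⟩

/-- A finite connected set without holes that has at least two points has a point with at most
three neighbours, all of them consecutive. -/
theorem exists_isShortArc {E : Finset Point} (hE : PathConnected (E : Set Point))
    (hco : PathConnected (E : Set Point)ᶜ) (hcard : 2 ≤ E.card) :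
    ∃ v ∈ E, ∃ d k, IsShortArc E v d k := by
  have hne : E.Nonempty := Finset.card_pos.1 (by omega)
  obtain ⟨v, hv, hpos⟩ : ∃ v ∈ E, 0 < curv E v := by
    apply Finset.exists_lt_of_sum_lt
    have := six_le_totalCurv E hne hco
    simp only [Finset.sum_const_zero]
    unfold totalCurv at this
    omega
  obtain ⟨d, k, h1, h2, h3⟩ := exists_short_arc_of_bool (fun d => decide (nbr v d ∈ E)) (by
      by_contra! hn
      obtain ⟨x, hx, hxv⟩ := Finset.exists_mem_ne (by omega : 1 < E.card) v
      exact hxv (hE.eq_of_isolated hv (fun d hd => hn d (by simpa using hd)) hx)) (by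
      simpa [curv, deg, tri, ind] using hpos)
  exact ⟨v, hv, d, k, h1, h2, by simpa using h3⟩

/-! ### Rays to infinity and the local form of SCE -/

theorem mem_outerFace_of_ray {x : Point} (e : ZMod 6) (h : ∀ n : ℕ, x + n • dir e ∉ S) :
    x ∈ outerFace S := by
  have hx : x ∈ Sᶜ := by simpa using h 0
  refine ⟨hx, ?_⟩
  refine Set.infinite_of_injective_forall_mem
    (f := fun n : ℕ => (⟨x + n • dir e, h n⟩ : (Sᶜ : Set Point))) ?_ ?_
  · intro m n hmn
    exact ray_injective x e (congrArg Subtype.val hmn)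
  · intro n
    rw [SimpleGraph.ConnectedComponent.mem_supp_iff, SimpleGraph.ConnectedComponent.eq,
      reachable_induce_iff]
    apply Joined.symm
    change Joined Sᶜ x (x + n • dir e)
    induction n with
    | zero => simpa using Joined.refl Sᶜ x
    | succ n ih =>
      refine ih.trans (.of_adj ⟨e, ?_⟩ (h n) (h (n + 1)))
      rw [nbr, add_assoc, ← succ_nsmul]

/-- Among the six directions, proportional coordinates with a positive scalar product determine the
direction. -/
theorem succ_smul_dir_eq (n : ℕ) (e j : ZMod 6) (h : (n + 1) • dir e = dir j) : e = j := by
  have key : ∀ e j : ZMod 6, ((dir e).1 * (dir j).2 = (dir e).2 * (dir j).1) →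
      0 < (dir e).1 * (dir j).1 + (dir e).2 * (dir j).2 → e = j := by decide
  have h1 := congrArg Prod.fst h
  have h2 := congrArg Prod.snd h
  simp only [nsmul_eq_mul, Prod.fst_mul, Prod.snd_mul, Prod.fst_natCast,
    Prod.snd_natCast] at h1 h2
  have h0 : 0 < (dir e).1 * (dir e).1 + (dir e).2 * (dir e).2 := by
    have : ∀ e : ZMod 6, 0 < (dir e).1 * (dir e).1 + (dir e).2 * (dir e).2 := by decide
    exact this e
  apply key
  · rw [← h1, ← h2]; ring
  · rw [← h1, ← h2]
    have : (0 : ℤ) < ((n + 1 : ℕ) : ℤ) := by positivity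
    nlinarith [mul_pos this h0]

/-- For a set of points at distance at most one from `v`, the point `v` is strictly convex and
erodable iff it has at most three neighbours, all of them consecutive. -/
theorem isSCE_iff (hv : v ∈ S) (hS : ∀ x ∈ S, x = v ∨ grid.Adj v x) :
    IsSCE S v ↔ ∃ d k, IsShortArc S v d k := by
  constructor
  · rintro ⟨⟨⟨-, hred⟩, -⟩, d, k, ⟨-, -, hout, hpred, hsucc⟩, hk⟩
    have hk3 : 3 ≤ k := by unfold boundaryCount at hk; omega
    -- An interval of six or more edges would contain the edge in direction `d - 1`, which leads
    -- into `S`.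
    have hk6 : k < 6 := by
      by_contra! h6
      refine hout 5 (by omega) ?_
      rwa [show ((5 : ℕ) : ZMod 6) = -1 by decide, ← sub_eq_add_neg]
    refine ⟨d + k, 6 - k, by omega, by omega, ?_⟩
    -- The two ends of the complementary arc are in `S` by maximality. Only an arc of three has a
    -- further point, and without it the ends would be disconnected from each other, contrary to
    -- redundancy.
    have hmid : k = 3 → nbr v (d + 4) ∈ S := by
      rintro rfl
      by_contra h4
      have hpc := preconnected_induce_iff.1 hred
      have := (hpc (nbr v (d + 3)) ⟨hsucc, grid_adj_nbr v _⟩ (nbr v (d - 1))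
        ⟨hpred, grid_adj_nbr v _⟩).mem_of_closed (T := {nbr v (d + 3)}) rfl (by
          rintro a rfl b ⟨hb, e, rfl⟩ hab
          rw [grid_adj_nbr_nbr_iff] at hab
          rcases hab with rfl | rfl
          · exact absurd (by convert hb using 2; ring) h4
          · refine absurd hb ?_
            convert hout 2 (by omega) using 3
            push_cast; ring)
      rw [Set.mem_singleton_iff, nbr_inj, sub_eq_iff_eq_add, add_assoc, left_eq_add] at this
      exact absurd this (by decide)
    intro j
    obtain ⟨j, hj, rfl⟩ : ∃ i : ℕ, i < 6 ∧ (i : ZMod 6) = j :=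
      ⟨j.val, ZMod.val_lt j, ZMod.natCast_zmod_val j⟩
    rw [ZMod.val_natCast_of_lt hj, add_assoc, ← Nat.cast_add]
    have h6 : ((6 : ℕ) : ZMod 6) = 0 := by decide
    constructor
    · intro hm
      by_contra! hle
      refine hout (k + j - 6) (by omega) ?_
      rw [Nat.cast_sub (by omega), h6, sub_zero]
      exact hm
    · intro hlt
      rcases Nat.eq_zero_or_pos j with rfl | hj0
      · exact hsucc
      by_cases hlast : k + j = 5
      · rw [hlast, show ((5 : ℕ) : ZMod 6) = -1 by decide, ← sub_eq_add_neg]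
        exact hpred
      · have hk4 : k + j = 4 := by omega
        rw [hk4]
        exact hmid (by omega)
  · rintro ⟨d, k, h⟩
    have hk1 := h.one_le
    have hk3 := h.le_three
    -- Direction `d + 3` is never in an arc of at most three. The ray from there does not meet `S`
    -- again, since `S` stays within distance one of `v`.
    refine ⟨⟨⟨hv, ?_⟩, hv, d + (3 : ℕ), mem_outerFace_of_ray (d + (3 : ℕ)) ?_⟩,
      d + k, 6 - k, ⟨hv, by omega, ?_, ?_, ?_⟩, ?_⟩
    · rw [preconnected_induce_iff]
      refine .of_joined (nbr v d) ?_
      rintro x ⟨hx, e, rfl⟩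
      exact h.joined (T := {u | u ∈ S ∧ grid.Adj v u}) (fun e he => ⟨he, grid_adj_nbr v e⟩) e hx
    · intro n hn
      rw [nbr, add_assoc, ← succ_nsmul'] at hn
      rcases hS _ hn with h0 | ⟨j, hj⟩
      · rw [add_eq_left, ← zero_smul ℕ (dir (d + (3 : ℕ)))] at h0
        have := ray_injective 0 (d + (3 : ℕ)) (a₁ := n + 1) (a₂ := 0) (by simpa using h0)
        omega
      · rw [hj] at hn
        rw [nbr, add_right_inj] at hj
        rw [← succ_smul_dir_eq n _ _ hj, h.nbr_mem_iff 3 (by omega)] at hn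
        omega
    · intro j hj
      rw [add_assoc, ← Nat.cast_add, h.nbr_mem_iff _ (by omega)]
      omega
    · rw [show d + (k : ZMod 6) - 1 = d + ((k - 1 : ℕ) : ZMod 6) by
        push_cast [Nat.cast_sub hk1]; ring, h.nbr_mem_iff _ (by omega)]
      omega
    · rw [add_assoc, ← Nat.cast_add, show k + (6 - k) = 6 by omega,
        show ((6 : ℕ) : ZMod 6) = 0 by decide, add_zero]
      exact h.nbr_mem
    · unfold boundaryCount
      omega

end

section

/-! ### The outer face of a finite shape -/

variable {S T : Set Point} {x y : Point}

theorem joined_line (f : ℤ → Point) (hf : ∀ n, grid.Adj (f n) (f (n + 1)))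
    (hT : ∀ n, f n ∈ T) (a b : ℤ) : Joined T (f a) (f b) := by
  have key : ∀ (n : ℕ) (a : ℤ), Joined T (f a) (f (a + n)) := by
    intro n a
    induction n with
    | zero => simpa using Joined.refl T (f a)
    | succ n ih =>
      refine ih.trans (.of_adj ?_ (hT _) (hT _))
      simpa [add_assoc] using hf (a + n)
  rcases le_total a b with h | h
  · simpa [h] using key (b - a).toNat a
  · simpa [h] using (key (a - b).toNat b).symm

theorem joined_row {b : ℤ} (h : ∀ a, (a, b) ∈ T) (a a' : ℤ) : Joined T (a, b) (a', b) :=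
  joined_line (fun n => (n, b)) (fun n => by simp [grid_adj_iff]) h a a'

theorem joined_column {a : ℤ} (h : ∀ b, (a, b) ∈ T) (b b' : ℤ) : Joined T (a, b) (a, b') :=
  joined_line (fun n => (a, n)) (fun n => by simp [grid_adj_iff]) h b b'

theorem mem_compl_Icc {l h : Point} :
    x ∈ (Set.Icc l h)ᶜ ↔ x.1 < l.1 ∨ h.1 < x.1 ∨ x.2 < l.2 ∨ h.2 < x.2 := by
  simp only [Set.mem_compl_iff, Set.mem_Icc, Prod.le_def]
  omega

theorem pathConnected_compl_Icc (l h : Point) : PathConnected (Set.Icc l h)ᶜ := by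
  refine .of_joined (h.1 + 1, h.2 + 1) ?_
  rintro ⟨a, b⟩ hx
  rw [mem_compl_Icc] at hx
  -- If the row of the point misses the box, the path follows this row first; otherwise its column
  -- misses the box and is followed first.
  by_cases hb : b < l.2 ∨ h.2 < b
  · refine (joined_row (fun t => ?_) a (h.1 + 1)).trans (joined_column (fun t => ?_) b (h.2 + 1))
      <;> rw [mem_compl_Icc] <;> dsimp only <;> omega
  · refine (joined_column (fun t => ?_) b (h.2 + 1)).trans (joined_row (fun t => ?_) a (h.1 + 1))
      <;> rw [mem_compl_Icc] <;> dsimp only at * <;> omega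

theorem exists_subset_Icc (hS : S.Finite) : ∃ l h : Point, S ⊆ Set.Icc l h := by
  obtain ⟨l, hl⟩ := hS.bddBelow
  obtain ⟨h, hh⟩ := hS.bddAbove
  exact ⟨l, h, fun x hx => ⟨hl hx, hh hx⟩⟩

theorem compl_Icc_subset_outerFace {l h : Point} (hS : S ⊆ Set.Icc l h) :
    (Set.Icc l h)ᶜ ⊆ outerFace S := by
  intro x hx
  rw [mem_compl_Icc] at hx
  have key : ∀ e : ZMod 6, (∀ n : ℕ, x + n • dir e ∈ (Set.Icc l h)ᶜ) → x ∈ outerFace S :=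
    fun e he => mem_outerFace_of_ray e fun n hn => he n (hS hn)
  simp only [mem_compl_Icc, Prod.fst_add, Prod.snd_add, nsmul_eq_mul, Prod.fst_mul,
    Prod.snd_mul, Prod.fst_natCast, Prod.snd_natCast] at key
  rcases hx with hx | hx | hx | hx
  · refine key 3 fun n => Or.inl ?_
    rw [show (dir 3).1 = -1 from rfl]
    omega
  · refine key 0 fun n => Or.inr (Or.inl ?_)
    rw [show (dir 0).1 = 1 from rfl]
    omega
  · refine key 2 fun n => Or.inr (Or.inr (Or.inl ?_))
    rw [show (dir 2).2 = -1 from rfl]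
    omega
  · refine key 5 fun n => Or.inr (Or.inr (Or.inr ?_))
    rw [show (dir 5).2 = 1 from rfl]
    omega

theorem finite_compl_outerFace (hS : S.Finite) : (outerFace S)ᶜ.Finite := by
  obtain ⟨l, h, hlh⟩ := exists_subset_Icc hS
  exact (Set.finite_Icc l h).subset (Set.compl_subset_comm.1 (compl_Icc_subset_outerFace hlh))

theorem mem_outerFace_of_adj (hx : x ∈ outerFace S) (hxy : grid.Adj x y) (hy : y ∉ S) :
    y ∈ outerFace S := by
  obtain ⟨hxS, hinf⟩ := hx
  refine ⟨hy, ?_⟩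
  have : (grid.induce Sᶜ).connectedComponentMk ⟨y, hy⟩ =
      (grid.induce Sᶜ).connectedComponentMk ⟨x, hxS⟩ := by
    rw [SimpleGraph.ConnectedComponent.eq, reachable_induce_iff]
    exact .of_adj hxy.symm hy hxS
  rwa [this]

theorem Joined.joined_outerFace (h : Joined Sᶜ x y) (hx : x ∈ outerFace S) :
    y ∈ outerFace S ∧ Joined (outerFace S) x y := by
  induction h with
  | refl => exact ⟨hx, .refl _ _⟩
  | tail _ hbc ih =>
    have := mem_outerFace_of_adj ih.1 hbc.1 hbc.2.2
    exact ⟨this, ih.2.trans (.of_adj hbc.1 ih.1 this)⟩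

/-- An infinite component cannot fit in a bounding box of `S`, so each one reaches the complement of
the box, which is connected and lies in the outer face. -/
theorem pathConnected_outerFace (hS : S.Finite) : PathConnected (outerFace S) := by
  obtain ⟨l, h, hlh⟩ := exists_subset_Icc hS
  have key : ∀ x ∈ outerFace S, ∃ y ∈ (Set.Icc l h)ᶜ, Joined (outerFace S) x y := by
    rintro x ⟨hx, hinf⟩
    obtain ⟨y, hy, hyI⟩ := (hinf.image (Subtype.val_injective.injOn)).exists_notMem_finite
      (Set.finite_Icc l h)
    obtain ⟨⟨y, hyS⟩, hy, rfl⟩ := hy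
    rw [SimpleGraph.ConnectedComponent.mem_supp_iff, SimpleGraph.ConnectedComponent.eq,
      reachable_induce_iff] at hy
    exact ⟨y, hyI, (hy.symm.joined_outerFace ⟨hx, hinf⟩).2⟩
  intro x hx y hy
  obtain ⟨x', hx', hxx⟩ := key x hx
  obtain ⟨y', hy', hyy⟩ := key y hy
  exact (hxx.trans ((pathConnected_compl_Icc l h x' hx' y' hy').mono
    (compl_Icc_subset_outerFace hlh))).trans hyy.symm

/-- An eastward walk must eventually enter the outer face, and it can do so only from a point of
`S`. So every point enclosed by `S` is joined to the connected set `S`. -/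
theorem pathConnected_compl_outerFace (hS : S.Finite) (hc : PathConnected S) :
    PathConnected (outerFace S)ᶜ := by
  have hsub : S ⊆ (outerFace S)ᶜ := fun x hx ho => ho.1 hx
  have key : ∀ n : ℕ, ∀ x ∈ (outerFace S)ᶜ, x + n • dir 0 ∉ (outerFace S)ᶜ →
      ∃ y ∈ S, Joined (outerFace S)ᶜ x y := by
    intro n
    induction n with
    | zero => intro x hx hn; exact absurd hx (by simpa using hn)
    | succ n ih =>
      intro x hx hn
      by_cases hxS : x ∈ S
      · exact ⟨x, hxS, .refl _ _⟩
      · have hx' : nbr x 0 ∈ (outerFace S)ᶜ :=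
          fun ho => hx (mem_outerFace_of_adj ho (grid_adj_nbr x 0).symm hxS)
        obtain ⟨y, hy, hj⟩ := ih (nbr x 0) hx' (by rwa [nbr, add_assoc, ← succ_nsmul'])
        exact ⟨y, hy, (Joined.of_adj (grid_adj_nbr x 0) hx hx').trans hj⟩
  have key' : ∀ x ∈ (outerFace S)ᶜ, ∃ y ∈ S, Joined (outerFace S)ᶜ x y := by
    intro x hx
    obtain ⟨n, hn⟩ := exists_ray_notMem (finite_compl_outerFace hS) x 0
    exact key n x hx hn
  intro x hx y hy
  obtain ⟨x', hx', hxx⟩ := key' x hx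
  obtain ⟨y', hy', hyy⟩ := key' y hy
  exact (hxx.trans ((hc x' hx' y' hy').mono hsub)).trans hyy.symm

end

section

/-! ### The invariant of the algorithm -/

variable {P : Type*} {ori : P → ZMod 6} {C : Config P} {E : Finset Point} {p : P}

/-- `E` is the set of eligible points of the configuration `C`. -/
structure Inv (ori : P → ZMod 6) (C : Config P) (E : Finset Point) : Prop where
  nonempty : E.Nonempty
  conn : PathConnected (E : Set Point)
  conn_compl : PathConnected (E : Set Point)ᶜ
  injective : Function.Injective C.head
  interior : ∀ x ∈ E, x ∉ C.shape → ∀ d, nbr x d ∈ E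
  expanded : ∀ p, ¬ C.Contracted p → C.tail p ∉ E ∧ (C.mem p).status = Status.undecided
  undecided : ∀ p, (C.mem p).status = Status.undecided → C.head p ∈ E
  leader : ∀ p, (C.mem p).status = Status.leader → E = {C.head p}
  follower : ∀ p, (C.mem p).status = Status.follower → C.head p ∉ E
  eligible : ∀ p, C.head p ∈ E → ∀ i,
    (C.mem p).eligible i = true ↔ reach ori p (C.head p) i ∈ E
  terminated : ∀ p, (C.mem p).terminated = true → (C.mem p).status ≠ Status.undecided

/-- An unoccupied point of `E` lies in a hole, and no point of a hole is adjacent to the outer face.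
-/
theorem IsInitial.exists_inv [Finite P] (h : IsInitial ori C) : ∃ E, Inv ori C E := by
  have hhead : ∀ p, C.head p ∈ C.shape := fun p => ⟨p, Or.inl rfl⟩
  have hfin : C.shape.Finite := by
    refine ((Set.finite_range C.head).union (Set.finite_range C.tail)).subset ?_
    rintro x ⟨p, rfl | rfl⟩
    · exact Or.inl ⟨p, rfl⟩
    · exact Or.inr ⟨p, rfl⟩
  have hconn := preconnected_induce_iff.1 h.connected.preconnected
  obtain ⟨E, hE⟩ := (finite_compl_outerFace hfin).exists_finset_coe
  have hmem : ∀ x, x ∈ E ↔ x ∉ outerFace C.shape := fun x => by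
    rw [← Finset.mem_coe, hE, Set.mem_compl_iff]
  have hsub : ∀ x ∈ C.shape, x ∈ E := fun x hx => (hmem x).2 fun ho => ho.1 hx
  refine ⟨E, ?_, ?_, ?_, h.injective, ?_, ?_, ?_, ?_, ?_, ?_, ?_⟩
  · obtain ⟨x, hx⟩ := h.connected.nonempty
    exact ⟨x, hsub x hx⟩
  · rw [hE]; exact pathConnected_compl_outerFace hfin hconn
  · rw [hE, compl_compl]; exact pathConnected_outerFace hfin
  · intro x hx hxS d
    rw [hmem] at hx ⊢
    exact fun ho => hx (mem_outerFace_of_adj ho (grid_adj_nbr x d).symm hxS)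
  · intro p hp; exact absurd (h.contracted p) hp
  · intro p _; exact hsub _ (hhead p)
  · intro p hp; simp [h.status p] at hp
  · intro p hp; simp [h.status p] at hp
  · intro p _ i
    rw [hmem, h.eligible, ← h.outer p i]
    simp
  · intro p hp; simp [h.terminated p] at hp

theorem Inv.occupied (h : Inv ori C E) {x : Point} (hx : x ∈ E) (hs : x ∈ C.shape) :
    ∃ p, C.head p = x := by
  obtain ⟨p, rfl | rfl⟩ := hs
  · exact ⟨p, rfl⟩
  · by_contra! hn
    have hc : ¬ C.Contracted p := fun hc => hn p hc.symm
    exact (h.expanded p hc).1 hx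

theorem Inv.mem_view_iff (h : Inv ori C E) (hp : C.head p ∈ E) (e : ZMod 6) :
    nbr (C.head p) e ∈ C.view ori p ↔ nbr (C.head p) e ∈ E := by
  constructor
  · rintro (he | ⟨i, hi, he⟩)
    · exact absurd he (nbr_ne_self _ _)
    · rw [he]; exact (h.eligible p hp i).1 hi
  · intro he
    have : nbr (C.head p) e = reach ori p (C.head p) (e - ori p) := by simp [reach]
    rw [this] at he
    exact Or.inr ⟨e - ori p, (h.eligible p hp _).2 he, this⟩

theorem Inv.isSCE_view_iff (h : Inv ori C E) (hp : C.head p ∈ E) :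
    IsSCE (C.view ori p) (C.head p) ↔ ∃ d k, IsShortArc E (C.head p) d k := by
  rw [isSCE_iff (Or.inl rfl)]
  · refine exists_congr fun d => exists_congr fun k => ?_
    constructor
    · rintro ⟨h1, h3, hm⟩
      exact ⟨h1, h3, fun j => by rw [← hm, Finset.mem_coe, h.mem_view_iff hp]⟩
    · rintro ⟨h1, h3, hm⟩
      exact ⟨h1, h3, fun j => by rw [← hm, Finset.mem_coe, h.mem_view_iff hp]⟩
  · rintro x (rfl | ⟨i, -, rfl⟩)
    · exact Or.inl rfl
    · exact Or.inr (grid_adj_nbr _ _)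

theorem Inv.status_ne_leader_of_arc {v : Point} {d : ZMod 6} {k : ℕ} (h : Inv ori C E)
    (ha : IsShortArc E v d k) (hv : v ∈ E) (q : P) : (C.mem q).status ≠ Status.leader := by
  intro hq
  have hE := h.leader q hq
  have h1 := ha.nbr_mem
  rw [hE] at h1 hv
  simp only [Finset.coe_singleton, Set.mem_singleton_iff, Finset.mem_singleton] at h1 hv
  exact nbr_ne_self v d (h1.trans hv.symm)

/-! ### Preservation of the invariant -/

/-- The vacated tail is not in `E`, so no eligible point becomes unoccupied. -/
theorem Inv.contract (h : Inv ori C E) (hp : ¬ C.Contracted p) : Inv ori (C.contract p) E := by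
  have htail : ∀ q, q ≠ p → (C.contract p).tail q = C.tail q := fun q hq => by
    simp [Config.contract, hq]
  refine ⟨h.nonempty, h.conn, h.conn_compl, h.injective, ?_, ?_, h.undecided, h.leader,
    h.follower, h.eligible, h.terminated⟩
  · intro x hx hxs
    refine h.interior x hx fun hs => hxs ?_
    obtain ⟨q, rfl⟩ := h.occupied hx hs
    exact ⟨q, Or.inl rfl⟩
  · intro q hq
    have hqp : q ≠ p := by
      rintro rfl
      exact hq (by simp [Config.Contracted, Config.contract])
    rw [htail q hqp]
    exact h.expanded q fun hc => hq ((htail q hqp).trans hc)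

/-- A contracted particle changes its status and possibly terminates. -/
theorem Inv.setMem {m : Memory} (h : Inv ori C E) (hp : C.Contracted p)
    (he : m.eligible = (C.mem p).eligible)
    (hu : m.status ≠ Status.undecided)
    (hl : m.status = Status.leader → E = {C.head p})
    (hf : m.status = Status.follower → C.head p ∉ E) : Inv ori (C.setMem p m) E := by
  classical
  refine ⟨h.nonempty, h.conn, h.conn_compl, h.injective, h.interior, ?_, ?_, ?_, ?_, ?_, ?_⟩
  all_goals
    intro q
    by_cases hq : q = p
    · subst hq
      simp only [Config.setMem, Function.update_self]
      first
      | exact fun hn => absurd hp hn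
      | exact fun hn => absurd hn hu
      | exact hl
      | exact hf
      | (rw [he]; exact h.eligible q)
      | exact fun _ => hu
    · simp only [Config.setMem, Function.update_of_ne hq]
      first
      | exact h.expanded q
      | exact h.undecided q
      | exact h.leader q
      | exact h.follower q
      | exact h.eligible q
      | exact h.terminated q

theorem Inv.notify_eligible_iff (h : Inv ori C E) {q : P} (hq : q ≠ p) (hqE : C.head q ∈ E)
    (i : ZMod 6) : ((C.notify ori p (C.head p)).mem q).eligible i = true ↔
      reach ori q (C.head q) i ∈ E.erase (C.head p) := by
  rw [Finset.mem_erase, ← h.eligible q hqE i]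
  by_cases hr : reach ori q (C.head q) i = C.head p
  · have : C.Neighbor p q := ⟨hq, C.head p, C.head q, Or.inl rfl, Or.inl rfl,
      SimpleGraph.Adj.symm ⟨ori q + i, hr.symm⟩⟩
    simp [Config.notify, hr, this]
  · simp [Config.notify, hr]

/-- The point of a contracted undecided particle is removed from the set of eligible points; the
particle either stays there as a follower or expands into an eligible point `u`. -/
theorem Inv.erase {C' : Config P} {d : ZMod 6} {k : ℕ} (h : Inv ori C E) (hp : C.Contracted p)
    (hu : (C.mem p).status = Status.undecided) (ha : IsShortArc E (C.head p) d k)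
    (hhead : ∀ q, q ≠ p → C'.head q = C.head q)
    (htail : ∀ q, C'.tail q = C.tail q)
    (hmem : ∀ q, q ≠ p → C'.mem q = (C.notify ori p (C.head p)).mem q)
    (hshape : C.shape ⊆ C'.shape)
    (hmid : ∀ x ∈ E, x ∉ C'.shape → x ≠ nbr (C.head p) (d + 1))
    (hp' : (C'.mem p).status = Status.follower ∧ C'.head p = C.head p ∨
      (C'.mem p).status = Status.undecided ∧ C'.head p ∈ E ∧ C'.head p ∉ C.shape ∧
        ∀ i, (C'.mem p).eligible i = true ↔
          reach ori p (C'.head p) i ∈ E.erase (C.head p))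
    (hterm : (C'.mem p).terminated = false) : Inv ori C' (E.erase (C.head p)) := by
  have hvE : C.head p ∈ E := h.undecided p hu
  have hcoe : ((E.erase (C.head p) : Finset Point) : Set Point) = (E : Set Point) \ {C.head p} :=
    Finset.coe_erase _ _
  have hst : ∀ q, q ≠ p → (C'.mem q).status = (C.mem q).status := fun q hq => by
    rw [hmem q hq]; rfl
  have hin : ∀ q, C.head q ∈ C.shape := fun q => ⟨q, Or.inl rfl⟩
  have hne : ∀ q, q ≠ p → C'.head q ≠ C'.head p := by
    intro q hq heq
    rw [hhead q hq] at heq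
    rcases hp' with ⟨-, h2⟩ | ⟨-, -, h2, -⟩
    · exact hq (h.injective (heq.trans h2))
    · exact h2 (heq ▸ hin q)
  refine ⟨⟨nbr (C.head p) d, Finset.mem_erase.2 ⟨nbr_ne_self _ _, ha.nbr_mem⟩⟩, ?_, ?_, ?_, ?_, ?_,
    ?_, ?_, ?_, ?_, ?_⟩
  · rw [hcoe]; exact ha.pathConnected_diff hvE h.conn
  · obtain ⟨e, he⟩ := ha.exists_nbr_notMem
    rw [hcoe]; exact h.conn_compl.compl_diff he
  · intro q r hqr
    by_cases hq : q = p
    · by_cases hr : r = p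
      · rw [hq, hr]
      · subst hq; exact absurd hqr.symm (hne r hr)
    · by_cases hr : r = p
      · subst hr; exact absurd hqr (hne q hq)
      · rw [hhead q hq, hhead r hr] at hqr
        exact h.injective hqr
  · intro x hx hxs e
    have hxE := Finset.mem_of_mem_erase hx
    have hint := h.interior x hxE fun hs => hxs (hshape hs)
    -- An unoccupied `x` adjacent to the erased point would be the middle of the arc, which `hmid`
    -- says is occupied.
    refine Finset.mem_erase.2 ⟨fun heq => hmid x hxE hxs ?_, hint e⟩
    rw [nbr_eq_iff] at heq
    rw [← ha.eq_middle (e := e + 3) (by rw [← heq]; exact hxE) (by rw [← heq]; exact hint)]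
    exact heq
  · intro q hq
    by_cases hqp : q = p
    · subst hqp
      rcases hp' with ⟨-, h2⟩ | ⟨h1, -⟩
      · exact absurd ((htail q).trans (hp.trans h2.symm)) hq
      · refine ⟨?_, h1⟩
        rw [htail, show C.tail q = C.head q from hp]
        simp
    · rw [htail, hst q hqp]
      obtain ⟨h1, h2⟩ := h.expanded q fun hc => hq ((htail q).trans (hc.trans (hhead q hqp).symm))
      exact ⟨fun hm => h1 (Finset.mem_of_mem_erase hm), h2⟩
  · intro q hq
    by_cases hqp : q = p
    · subst hqp
      rcases hp' with ⟨h1, -⟩ | ⟨-, h1, h2, -⟩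
      · simp [h1] at hq
      · exact Finset.mem_erase.2 ⟨fun heq => h2 (heq ▸ hin q), h1⟩
    · rw [hst q hqp] at hq
      rw [hhead q hqp]
      exact Finset.mem_erase.2 ⟨fun heq => hqp (h.injective heq), h.undecided q hq⟩
  · intro q hq
    by_cases hqp : q = p
    · subst hqp
      rcases hp' with ⟨h1, -⟩ | ⟨h1, -⟩ <;> simp [h1] at hq
    · rw [hst q hqp] at hq
      exact absurd hq (h.status_ne_leader_of_arc ha hvE q)
  · intro q hq
    by_cases hqp : q = p
    · subst hqp
      rcases hp' with ⟨-, h1⟩ | ⟨h1, -⟩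
      · simp [h1]
      · simp [h1] at hq
    · rw [hst q hqp] at hq
      rw [hhead q hqp]
      exact fun hm => h.follower q hq (Finset.mem_of_mem_erase hm)
  · intro q hq i
    by_cases hqp : q = p
    · subst hqp
      rcases hp' with ⟨-, h1⟩ | ⟨-, -, -, h1⟩
      · simp [h1] at hq
      · exact h1 i
    · rw [hhead q hqp] at hq ⊢
      rw [hmem q hqp]
      exact h.notify_eligible_iff hqp (Finset.mem_of_mem_erase hq) i
  · intro q hq
    by_cases hqp : q = p
    · subst hqp; simp [hterm] at hq
    · rw [hst q hqp]
      rw [hmem q hqp] at hq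
      exact h.terminated q hq

theorem Inv.expand {d : ZMod 6} {k : ℕ} {i : ZMod 6} (h : Inv ori C E) (hp : C.Contracted p)
    (hu : (C.mem p).status = Status.undecided) (ht : (C.mem p).terminated = false)
    (ha : IsShortArc E (C.head p) d k) (hi : (C.mem p).eligible i = true)
    (hr : reach ori p (C.head p) i ∉ C.shape) :
    Inv ori (((C.notify ori p (C.head p)).setMem p
      { C.mem p with eligible := fun j => if j = i + 3 then false else true }).expand p
        (reach ori p (C.head p) i)) (E.erase (C.head p)) := by
  have hvE : C.head p ∈ E := h.undecided p hu
  have hrE := (h.eligible p hvE i).1 hi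
  have hint := h.interior _ hrE hr
  have hmid := ha.eq_middle (e := ori p + i) hrE hint
  refine h.erase hp hu ha ?_ ?_ ?_ ?_ ?_ (Or.inr ⟨?_, ?_, ?_, ?_⟩) ?_
  · intro q hq; simp [Config.expand, Config.setMem, Config.notify, hq]
  · intro q; rfl
  · intro q hq; simp [Config.expand, Config.setMem, hq]
  · rintro x ⟨q, hq⟩
    by_cases hqp : q = p
    · subst hqp
      refine ⟨q, Or.inr ?_⟩
      rw [Config.Occupies, show C.tail q = C.head q from hp, or_self] at hq
      exact hq.trans hp.symm
    · exact ⟨q, by simpa [Config.Occupies, Config.expand, Config.setMem, Config.notify, hqp]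
        using hq⟩
  -- The middle of the arc is precisely the point that the particle expands into.
  · rintro x - hx rfl
    refine hx ⟨p, Or.inl ?_⟩
    simp [Config.expand, reach, hmid]
  · simpa [Config.expand, Config.setMem] using hu
  · simpa [Config.expand] using hrE
  · simpa [Config.expand] using hr
  · intro j
    have hback : reach ori p (reach ori p (C.head p) i) (i + 3) = C.head p := by
      rw [reach, reach, ← add_assoc, nbr_nbr_opposite]
    by_cases hj : j = i + 3
    · subst hj
      simp [Config.expand, Config.setMem, hback]
    · simp only [Config.expand, Config.setMem, Function.update_self, hj, if_false, true_iff]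
      -- The new head was unoccupied, so all its neighbours were eligible; only the old point,
      -- behind port `i + 3`, has been erased. This justifies setting the flags without looking.
      refine Finset.mem_erase.2 ⟨fun heq => hj ?_, hint _⟩
      exact add_left_cancel (nbr_inj.1 (heq.trans hback.symm))
  · simpa [Config.expand, Config.setMem] using ht

theorem Inv.follow {d : ZMod 6} {k : ℕ} (h : Inv ori C E) (hp : C.Contracted p)
    (hu : (C.mem p).status = Status.undecided) (ht : (C.mem p).terminated = false)
    (ha : IsShortArc E (C.head p) d k)
    (hn : ¬ ∃ i, (C.mem p).eligible i = true ∧ reach ori p (C.head p) i ∉ C.shape) :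
    Inv ori ((C.notify ori p (C.head p)).setMem p
      { C.mem p with status := Status.follower }) (E.erase (C.head p)) := by
  have hvE : C.head p ∈ E := h.undecided p hu
  refine h.erase hp hu ha ?_ ?_ ?_ ?_ ?_ (Or.inl ⟨?_, rfl⟩) ?_
  · intro q _; rfl
  · intro q; rfl
  · intro q hq; simp [Config.setMem, hq]
  · exact fun x hx => hx
  · rintro x hxE hx rfl
    have hreach : reach ori p (C.head p) (d + 1 - ori p) = nbr (C.head p) (d + 1) := by
      simp [reach]
    exact hn ⟨d + 1 - ori p, (h.eligible p hvE _).2 (hreach ▸ hxE), fun hs => hx (hreach ▸ hs)⟩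
  · simp [Config.setMem]
  · simpa [Config.setMem] using ht

theorem Inv.eq_singleton (h : Inv ori C E) (hp : C.head p ∈ E)
    (hn : ∀ i, (C.mem p).eligible i = false) : E = {C.head p} := by
  refine Finset.eq_singleton_iff_unique_mem.2 ⟨hp, fun x hx => ?_⟩
  refine h.conn.eq_of_isolated hp (fun e he => ?_) hx
  have := (h.eligible p hp (e - ori p)).2 (by simpa [reach] using he)
  simp [hn] at this

/-! ### Termination -/

open Classical in
/-- What the particle `p` still has to do, not counting erosions. -/
noncomputable def pending (C : Config P) (p : P) : ℕ :=
  (if C.Contracted p then 0 else 1) + (if (C.mem p).status = Status.undecided then 1 else 0) +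
    if (C.mem p).terminated = true then 0 else 1

/-- A measure that decreases with each activation that changes the configuration. -/
noncomputable def work [Fintype P] (C : Config P) (E : Finset Point) : ℕ :=
  2 * E.card + ∑ p, pending C p

theorem work_lt_work [Fintype P] {C' : Config P} {E' : Finset Point}
    (hhead : ∀ q, q ≠ p → C'.head q = C.head q) (htail : ∀ q, q ≠ p → C'.tail q = C.tail q)
    (hstatus : ∀ q, q ≠ p → (C'.mem q).status = (C.mem q).status)
    (hterm : ∀ q, q ≠ p → (C'.mem q).terminated = (C.mem q).terminated)
    (hlt : 2 * E'.card + pending C' p < 2 * E.card + pending C p) : work C' E' < work C E := by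
  classical
  have h : ∀ q, q ≠ p → pending C' q = pending C q := fun q hq => by
    rw [pending, pending, Config.Contracted, Config.Contracted, hhead q hq, htail q hq,
      hstatus q hq, hterm q hq]
  rw [work, work, ← Finset.add_sum_erase _ _ (Finset.mem_univ p),
    ← Finset.add_sum_erase _ (pending C) (Finset.mem_univ p),
    Finset.sum_congr rfl fun q hq => h q (Finset.ne_of_mem_erase hq)]
  linarith

open Classical in
theorem work_setMem_lt_work [Fintype P] {m : Memory} (hp : C.Contracted p)
    (h : (if m.status = Status.undecided then 1 else 0) + (if m.terminated = true then 0 else 1) <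
      (if (C.mem p).status = Status.undecided then 1 else 0) +
        if (C.mem p).terminated = true then 0 else 1) :
    work (C.setMem p m) E < work C E := by
  refine work_lt_work (p := p) (fun _ _ => rfl) (fun _ _ => rfl) (fun q hq => ?_)
    (fun q hq => ?_) ?_
  · simp [Config.setMem, hq]
  · simp [Config.setMem, hq]
  · have hp' : (C.setMem p m).Contracted p := hp
    have hm : (C.setMem p m).mem p = m := by simp [Config.setMem]
    rw [pending, pending, if_pos hp, if_pos hp', hm]
    omega

/-- Expanding makes the particle non-contracted, which adds 1 to `pending`, but erases a point of
`E`, which counts 2 in `work`; hence the weight 2. -/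
theorem Inv.step [Fintype P] {C' : Config P} (h : Inv ori C E) (hact : Activate ori p C C') :
    ∃ E', Inv ori C' E' ∧ (C' = C ∨ work C' E' < work C E) := by
  unfold Activate at hact
  dsimp only at hact
  split_ifs at hact with ht hc hs hu hel hsce hex
  · exact ⟨E, hact ▸ h, Or.inl hact⟩
  · subst hact
    refine ⟨E, h.setMem hc rfl hs.1 (h.leader p) (h.follower p),
      Or.inr (work_setMem_lt_work hc ?_)⟩
    simp [hs.1, ht]
  · subst hact
    refine ⟨E, h.setMem hc rfl (by simp) (fun _ => h.eq_singleton (h.undecided p hu) hel)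
      (by simp), Or.inr (work_setMem_lt_work hc ?_)⟩
    simp [hu, ht]
  · have ht' : (C.mem p).terminated = false := by simpa using ht
    obtain ⟨d, k, ha⟩ := (h.isSCE_view_iff (h.undecided p hu)).1 hsce
    obtain ⟨i, hi, hr, rfl⟩ := hact
    have hcard := Finset.card_erase_add_one (h.undecided p hu)
    refine ⟨_, h.expand hc hu ht' ha hi hr, Or.inr (work_lt_work (p := p) (fun q hq => ?_)
      (fun _ _ => rfl) (fun q hq => ?_) (fun q hq => ?_) ?_)⟩
    · simp [Config.expand, Config.setMem, Config.notify, hq]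
    · simp [Config.expand, Config.setMem, Config.notify, hq]
    · simp [Config.expand, Config.setMem, Config.notify, hq]
    · rw [pending, pending, if_pos hc, if_pos hu, if_neg ht]
      split_ifs <;> omega
  · subst hact
    have ht' : (C.mem p).terminated = false := by simpa using ht
    obtain ⟨d, k, ha⟩ := (h.isSCE_view_iff (h.undecided p hu)).1 hsce
    have hcard := Finset.card_erase_add_one (h.undecided p hu)
    refine ⟨_, h.follow hc hu ht' ha hex, Or.inr (work_lt_work (p := p) (fun _ _ => rfl)
      (fun _ _ => rfl) (fun q hq => ?_) (fun q hq => ?_) ?_)⟩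
    · simp [Config.setMem, Config.notify, hq]
    · simp [Config.setMem, Config.notify, hq]
    · rw [pending, pending, if_pos hc, if_pos hu, if_neg ht]
      split_ifs <;> omega
  · exact ⟨E, hact ▸ h, Or.inl hact⟩
  · exact ⟨E, hact ▸ h, Or.inl hact⟩
  · subst hact
    refine ⟨E, h.contract hc, Or.inr (work_lt_work (p := p) (fun _ _ => rfl) (fun q hq => ?_)
      (fun _ _ => rfl) (fun _ _ => rfl) ?_)⟩
    · simp [Config.contract, hq]
    · have hc' : (C.contract p).Contracted p := by simp [Config.Contracted, Config.contract]
      rw [pending, pending, if_neg hc, if_pos hc', show (C.contract p).mem = C.mem from rfl]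
      omega

theorem IsExecution.exists_stable [Fintype P] {C : ℕ → Config P} {a : ℕ → P}
    (h : IsExecution ori C a) (n t : ℕ) (E : Finset Point) (hE : Inv ori (C t) E)
    (hn : work (C t) E ≤ n) : ∃ T, (∃ E, Inv ori (C T) E) ∧ ∀ s, T ≤ s → C s = C T := by
  induction n using Nat.strong_induction_on generalizing t E with
  | _ n ih =>
  by_cases hst : ∀ s, t ≤ s → C s = C t
  · exact ⟨t, ⟨E, hE⟩, hst⟩
  · push Not at hst
    classical
    -- At the first time `s` when the configuration differs from `C t`, the last activation was
    -- effective and decreased `work`.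
    obtain ⟨s, ⟨hts, hne⟩, hmin⟩ : ∃ s, (t ≤ s ∧ C s ≠ C t) ∧ ∀ r < s, ¬ (t ≤ r ∧ C r ≠ C t) :=
      ⟨Nat.find hst, Nat.find_spec hst, fun r => Nat.find_min hst⟩
    have hlt : t < s := lt_of_le_of_ne hts fun he => hne (he ▸ rfl)
    have hpre : C (s - 1) = C t := by
      by_contra hc
      exact hmin (s - 1) (by omega) ⟨by omega, hc⟩
    have hstep := h.step (s - 1)
    rw [hpre, show s - 1 + 1 = s by omega] at hstep
    obtain ⟨E', hE', heq | hwork⟩ := hE.step hstep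
    · exact absurd heq hne
    · exact ih (work (C s) E') (by omega) s E' hE' le_rfl

/-- In a configuration that no activation has to change, the election is over. -/
theorem Inv.elected (h : Inv ori C E) (hst : ∀ p, Activate ori p C C) :
    (∀ p, (C.mem p).terminated = true) ∧ LeaderElected C := by
  have hcontr : ∀ p, C.Contracted p := by
    intro p
    by_contra hc
    have hact := hst p
    have ht : ¬ (C.mem p).terminated = true := fun ht => h.terminated p ht (h.expanded p hc).2
    unfold Activate at hact
    dsimp only at hact
    rw [if_neg ht, if_pos hc] at hact
    have := congrArg (fun D => D.tail p) hact
    simp only [Config.contract, Function.update_self] at this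
    exact hc this
  have hund : ∀ p, (C.mem p).status = Status.undecided → ¬ (C.mem p).terminated = true :=
    fun p hp ht => h.terminated p ht hp
  have hcard : E.card ≤ 1 := by
    by_contra! hcard
    obtain ⟨v, hv, d, k, ha⟩ := exists_isShortArc h.conn h.conn_compl hcard
    obtain ⟨e, he⟩ := ha.exists_nbr_notMem
    -- A point with a short arc has a neighbour outside `E`, so it cannot be unoccupied.
    obtain ⟨p, rfl⟩ := h.occupied hv (by
      by_contra hs
      exact he (h.interior v hv hs e))
    have hu : (C.mem p).status = Status.undecided := by
      cases hp : (C.mem p).status with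
      | undecided => rfl
      | leader => exact absurd hp (h.status_ne_leader_of_arc ha hv p)
      | follower => exact absurd hv (h.follower p hp)
    have hact := hst p
    have hel : ¬ ∀ i, (C.mem p).eligible i = false := by
      intro hn
      have h1 := ha.nbr_mem
      rw [Finset.mem_coe, h.eq_singleton hv hn, Finset.mem_singleton] at h1
      exact nbr_ne_self _ _ h1
    have hsce := (h.isSCE_view_iff hv).2 ⟨d, k, ha⟩
    unfold Activate at hact
    dsimp only at hact
    -- The activation reaches the erosion branch, which changes either the head or the status of
    -- `p`, contrary to stability.
    rw [if_neg (hund p hu), if_neg (not_not.2 (hcontr p)), if_neg (fun hs => hs.1 hu),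
      if_pos hu, if_neg hel, if_pos hsce] at hact
    split_ifs at hact with hex
    · obtain ⟨i, -, -, heq⟩ := hact
      have := congrArg (fun D => D.head p) heq
      simp only [Config.expand, Function.update_self] at this
      exact nbr_ne_self _ _ this.symm
    · have := congrArg (fun D => (D.mem p).status) hact
      simp [Config.setMem, hu] at this
  obtain ⟨v, rfl⟩ := Finset.card_eq_one.1 (le_antisymm hcard h.nonempty.card_pos)
  have hiso : ∀ e, nbr v e ∉ ({v} : Finset Point) := fun e => by simp [nbr_ne_self]
  have hdec : ∀ p, (C.mem p).status ≠ Status.undecided := by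
    intro p hu
    have hact := hst p
    have hp := h.undecided p hu
    have hel : ∀ i, (C.mem p).eligible i = false := by
      intro i
      rw [← Bool.not_eq_true, h.eligible p hp, Finset.mem_singleton.1 hp]
      exact hiso _
    unfold Activate at hact
    dsimp only at hact
    rw [if_neg (hund p hu), if_neg (not_not.2 (hcontr p)), if_neg (fun hs => hs.1 hu),
      if_pos hu, if_pos hel] at hact
    have := congrArg (fun D => (D.mem p).status) hact
    simp [Config.setMem, hu] at this
  refine ⟨fun p => ?_, ?_⟩
  · by_contra ht
    have hact := hst p
    have hnb : ∀ q, C.Neighbor p q → (C.mem q).status ≠ Status.undecided := fun q _ => hdec q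
    unfold Activate at hact
    dsimp only at hact
    rw [if_neg ht, if_neg (not_not.2 (hcontr p)), if_pos ⟨hdec p, hnb⟩] at hact
    have := congrArg (fun D => (D.mem p).terminated) hact
    simp only [Config.setMem, Function.update_self] at this
    exact ht this
  · obtain ⟨l, rfl⟩ := h.occupied (Finset.mem_singleton_self v) (by
      by_contra hs
      exact hiso 0 (h.interior v (by simp) hs 0))
    refine ⟨l, ?_, fun q hq => ?_⟩
    · cases hl : (C.mem l).status with
      | undecided => exact absurd hl (hdec l)
      | leader => rfl
      | follower => exact absurd (Finset.mem_singleton_self _) (h.follower l hl)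
    · cases hl : (C.mem q).status with
      | undecided => exact absurd hl (hdec q)
      | leader =>
        exact absurd (h.injective (Finset.singleton_injective (h.leader q hl)).symm) hq
      | follower => rfl

end

end DLE

theorem mainTheorem1 {P : Type*} [Finite P] (ori : P → ZMod 6)
    (C : ℕ → DLE.Config P) (a : ℕ → P)
    (hexec : DLE.IsExecution ori C a) (hfair : DLE.IsFair a) :
    ∃ T, ∀ t, T ≤ t →
      (∀ p, ((C t).mem p).terminated = true ∧ DLE.IsFinal ori (C t) p) ∧
        DLE.LeaderElected (C t) := by
  have := Fintype.ofFinite P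
  obtain ⟨E, hE⟩ := hexec.init.exists_inv
  obtain ⟨T, ⟨E', hE'⟩, hT⟩ := hexec.exists_stable _ 0 E hE le_rfl
  -- Fairness activates each particle after `T`, when the configuration is constant, so this
  -- activation maps `C T` to itself.
  obtain ⟨hterm, hlead⟩ := hE'.elected fun p => by
    obtain ⟨s, hs, rfl⟩ := hfair p T
    have := hexec.step s
    rwa [hT s hs, hT (s + 1) (by omega)] at this
  refine ⟨T, fun t ht => ?_⟩
  rw [hT t ht]
  refine ⟨fun p => ⟨hterm p, fun D D' hD _ hact => ?_⟩, hlead⟩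
  simpa only [DLE.Activate, hD, hterm p, if_true] using hact
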